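/- Let $G$ be a finite simple undirected graph and let $k \leq 6$ be a nonnegative integer. A coloring of $G$ is a partition of $V(G)$ into (nonempty) sets of pairwise nonadjacent vertices, and its size is the number of its classes. A coloring is a Kempe-coloring if the union of any two distinct classes induces a connected subgraph of $G$. A clique minor of $G$ is a set of nonempty, pairwise disjoint subsets of $V(G)$, each of which induces a connected subgraph of $G$, such that for any two distinct members there is an edge of $G$ with one end in each of them. Let $h(G)$ be the largest size of a clique minor of $G$. If $G$ has a Kempe-coloring of size $k$, then $h(G) \geq k$; equivalently, $G$ has a clique minor of size exactly $k$. -/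

import Mathlib

namespace SimpleGraph

variable {V : Type*}

/-- A coloring of `G` is a partition of the vertex set into (nonempty) sets of pairwise
nonadjacent vertices, i.e. Mathlib's `G.Partition`. It is a Kempe-coloring if the union of any two
distinct color classes induces a connected subgraph of `G`. -/
def Partition.IsKempe {G : SimpleGraph V} (C : G.Partition) : Prop :=
  ∀ A ∈ C.parts, ∀ B ∈ C.parts, A ≠ B → (G.induce (A ∪ B)).Connected

/-- A clique minor of `G`: a set of nonempty, connected, pairwise disjoint and pairwise adjacent
sets of vertices. A set of vertices is connected if it induces a connected subgraph, and two sets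
of vertices are adjacent if some edge has an end in each of them. -/
structure IsCliqueMinor (G : SimpleGraph V) (K : Set (Set V)) : Prop where
  nonempty : ∀ A ∈ K, A.Nonempty
  connected : ∀ A ∈ K, (G.induce A).Connected
  disjoint : ∀ A ∈ K, ∀ B ∈ K, A ≠ B → Disjoint A B
  adjacent : ∀ A ∈ K, ∀ B ∈ K, A ≠ B → ∃ a ∈ A, ∃ b ∈ B, G.Adj a b

/-- The Hadwiger number `h(G)` of a finite graph: the largest size of a clique minor of `G`. -/
noncomputable def hadwigerNumber (G : SimpleGraph V) : ℕ :=
  sSup {n : ℕ | ∃ K : Set (Set V), G.IsCliqueMinor K ∧ K.ncard = n}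

/-- For a finite graph, the supremum that defines `h(G)` is a maximum. -/
theorem isGreatest_hadwigerNumber [Finite V] (G : SimpleGraph V) :
    IsGreatest {n : ℕ | ∃ K : Set (Set V), G.IsCliqueMinor K ∧ K.ncard = n}
      G.hadwigerNumber := by
  have hb : BddAbove {n : ℕ | ∃ K : Set (Set V), G.IsCliqueMinor K ∧ K.ncard = n} := by
    refine ⟨(Set.univ : Set (Set V)).ncard, ?_⟩
    rintro n ⟨K, -, rfl⟩
    exact Set.ncard_le_ncard (Set.subset_univ K)
  have hn : {n : ℕ | ∃ K : Set (Set V), G.IsCliqueMinor K ∧ K.ncard = n}.Nonempty :=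
    ⟨0, ∅, ⟨by simp, by simp, by simp, by simp⟩, by simp⟩
  exact ⟨Nat.sSup_mem hn hb, fun n h => le_csSup hb h⟩

end SimpleGraph

namespace SimpleGraph

/-! The proof counts edges. With `n` vertices, two Kempe classes `A`, `B` span a connected bipartite
graph, hence at least `|A| + |B| - 1` edges. Summing over pairs of classes gives at least `(k-1)n -
k(k-1)/2` edges (`Partition.IsKempe.card_mul_le`).

For `k ≤ 6` that many edges force a `K_k` minor, by Mader's method
(`HasCliqueMinor.of_dense_of_neighborhoods`): delete a vertex or contract an edge while this costs
few edges; when neither is possible, some vertex has a small, dense neighborhood. A minor one size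
smaller is found there and the vertex is added to it. The thresholds `n`, `2n - 2`, `3n - 5`, `5n -
15` for sizes 3 to 6 feed one another in turn; the last is exactly the Kempe count for `k = 6`. -/

/-- `G` has a clique minor of size `k`, given by an indexed family of branch sets. -/
def HasCliqueMinor {V : Type*} (G : SimpleGraph V) (k : ℕ) : Prop :=
  ∃ f : Fin k → Set V, (∀ i, (G.induce (f i)).Connected) ∧
    (Pairwise fun i j => Disjoint (f i) (f j)) ∧
    Pairwise fun i j => ∃ a ∈ f i, ∃ b ∈ f j, G.Adj a b

/-- The graph obtained from `G` by identifying `y` with `x`. -/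
def identify {V : Type*} (G : SimpleGraph V) (x y : V) : SimpleGraph ({y}ᶜ : Set V) where
  Adj u v := u ≠ v ∧ (G.Adj u v ∨ ((u : V) = x ∧ G.Adj y v) ∨ ((v : V) = x ∧ G.Adj y u))
  symm := ⟨fun u v h => ⟨h.1.symm, by
    rcases h.2 with h | h | h
    · exact Or.inl h.symm
    · exact Or.inr (Or.inr h)
    · exact Or.inr (Or.inl h)⟩⟩
  loopless := ⟨fun u h => h.1 rfl⟩

/-! ### Clique minors under subgraphs, cones and contractions. -/

section Minors

variable {V W : Type*} {G : SimpleGraph V} {H : SimpleGraph W} {k : ℕ}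

theorem HasCliqueMinor.exists_isCliqueMinor (h : G.HasCliqueMinor k) :
    ∃ K : Set (Set V), G.IsCliqueMinor K ∧ K.ncard = k := by
  obtain ⟨f, hc, hd, ha⟩ := h
  have hne : ∀ i, (f i).Nonempty := fun i => Set.nonempty_coe_sort.1 (hc i).nonempty
  have hinj : Function.Injective f := by
    intro i j hij
    by_contra hne'
    have : Disjoint (f i) (f j) := hd hne'
    rw [hij, disjoint_self] at this
    exact (hne j).ne_empty this
  refine ⟨Set.range f, ⟨?_, ?_, ?_, ?_⟩, ?_⟩
  · rintro _ ⟨i, rfl⟩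
    exact hne i
  · rintro _ ⟨i, rfl⟩
    exact hc i
  · rintro _ ⟨i, rfl⟩ _ ⟨j, rfl⟩ hij
    exact hd fun h => hij (h ▸ rfl)
  · rintro _ ⟨i, rfl⟩ _ ⟨j, rfl⟩ hij
    exact ha fun h => hij (h ▸ rfl)
  · rw [← Set.image_univ, Set.ncard_image_of_injective _ hinj, Set.ncard_univ, Nat.card_fin]

theorem Connected.induce_image {A : Set W} (f : H →g G) (h : (H.induce A).Connected) :
    (G.induce (f '' A)).Connected := by
  refine h.map (⟨fun a => ⟨f a, a, a.2, rfl⟩, fun {a b} hab => f.map_rel hab⟩ :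
    H.induce A →g G.induce (f '' A)) ?_
  rintro ⟨_, a, ha, rfl⟩
  exact ⟨⟨a, ha⟩, rfl⟩

theorem HasCliqueMinor.map (f : H →g G) (hf : Function.Injective f) (h : H.HasCliqueMinor k) :
    G.HasCliqueMinor k := by
  obtain ⟨g, hc, hd, ha⟩ := h
  refine ⟨fun i => f '' g i, fun i => (hc i).induce_image f, fun i j hij => ?_, fun i j hij => ?_⟩
  · exact (Set.disjoint_image_iff hf).2 (hd hij)
  · obtain ⟨a, ha, b, hb, hab⟩ := ha hij
    exact ⟨f a, ⟨a, ha, rfl⟩, f b, ⟨b, hb, rfl⟩, f.map_rel hab⟩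

theorem HasCliqueMinor.succ_of_induce_neighborSet {v : V}
    (h : (G.induce (G.neighborSet v)).HasCliqueMinor k) : G.HasCliqueMinor (k + 1) := by
  obtain ⟨g, hc, hd, ha⟩ := h
  have hne : ∀ i, (g i).Nonempty := fun i => Set.nonempty_coe_sort.1 (hc i).nonempty
  have hv : ∀ i, v ∉ Subtype.val '' g i := by
    rintro i ⟨a, -, h⟩
    have := a.2
    rw [h] at this
    exact G.loopless.irrefl v this
  refine ⟨Fin.cons {v} (fun i => Subtype.val '' g i), ?_, ?_, ?_⟩
  · intro i
    refine Fin.cases ?_ (fun i => ?_) i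
    · change (G.induce {v}).Connected
      exact Connected.of_subsingleton
    · exact (hc i).induce_image (Embedding.induce _).toHom
  · intro i j
    refine Fin.cases ?_ (fun i => ?_) i <;> refine Fin.cases ?_ (fun j => ?_) j
    · simp
    · exact fun _ => Set.disjoint_singleton_left.2 (hv j)
    · exact fun _ => Set.disjoint_singleton_right.2 (hv i)
    · intro hij
      simp only [Fin.cons_succ]
      exact (Set.disjoint_image_iff Subtype.val_injective).2 (hd fun h => hij (h ▸ rfl))
  · intro i j
    refine Fin.cases ?_ (fun i => ?_) i <;> refine Fin.cases ?_ (fun j => ?_) j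
    · simp
    · intro _
      simp only [Fin.cons_succ, Fin.cons_zero]
      obtain ⟨a, ha⟩ := hne j
      exact ⟨v, rfl, a, ⟨a, ha, rfl⟩, a.2⟩
    · intro _
      simp only [Fin.cons_succ, Fin.cons_zero]
      obtain ⟨a, ha⟩ := hne i
      exact ⟨a, ⟨a, ha, rfl⟩, v, rfl, a.2.symm⟩
    · intro hij
      simp only [Fin.cons_succ]
      obtain ⟨a, ha, b, hb, hab⟩ := ha fun h : i = j => hij (h ▸ rfl)
      exact ⟨a, ⟨a, ha, rfl⟩, b, ⟨b, hb, rfl⟩, hab⟩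

/-- A walk in `H` lifts step by step: each edge lifts to an edge of `G`, and consecutive lifts are
joined inside a connected fiber. -/
theorem Connected.induce_preimage {φ : V → W} (hφ : ∀ w, (G.induce (φ ⁻¹' {w})).Connected)
    (hH : ∀ w w', H.Adj w w' → ∃ u v, φ u = w ∧ φ v = w' ∧ G.Adj u v) {A : Set W}
    (h : (H.induce A).Connected) : (G.induce (φ ⁻¹' A)).Connected := by
  have hfib : ∀ (u v : φ ⁻¹' A), φ u = φ v → (G.induce (φ ⁻¹' A)).Reachable u v := by
    intro u v huv
    have hsub : φ ⁻¹' {φ u} ⊆ φ ⁻¹' A := by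
      intro z hz
      have : φ z = φ u := hz
      change φ z ∈ A
      rw [this]
      exact u.2
    exact ((hφ (φ u)).preconnected ⟨u, rfl⟩ ⟨v, huv.symm⟩).map (G.induceHomOfLE hsub).toHom
  have key : ∀ a b : A, (H.induce A).Walk a b → ∀ u v : φ ⁻¹' A, φ u = a → φ v = b →
      (G.induce (φ ⁻¹' A)).Reachable u v := by
    intro a b p
    induction p with
    | nil => exact fun u v hu hv => hfib u v (hu.trans hv.symm)
    | @cons a c b hac p ih =>
      intro u v hu hv
      obtain ⟨s, t, hs, ht, hst⟩ := hH a c hac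
      have hsA : φ s ∈ A := by rw [hs]; exact a.2
      have htA : φ t ∈ A := by rw [ht]; exact c.2
      have h1 := hfib u ⟨s, hsA⟩ (hu.trans hs.symm)
      have h2 : (G.induce (φ ⁻¹' A)).Reachable ⟨s, hsA⟩ ⟨t, htA⟩ := Adj.reachable hst
      exact (h1.trans h2).trans (ih ⟨t, htA⟩ v ht hv)
  obtain ⟨a⟩ := h.nonempty
  obtain ⟨u⟩ := (hφ a).nonempty
  have : Nonempty (φ ⁻¹' A) := ⟨⟨u, by
    have : φ u = a := u.2
    change φ u ∈ A
    rw [this]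
    exact a.2⟩⟩
  refine Connected.mk fun u v => ?_
  obtain ⟨p⟩ := h.preconnected ⟨φ u, u.2⟩ ⟨φ v, v.2⟩
  exact key _ _ p u v rfl rfl

theorem HasCliqueMinor.of_contraction {φ : V → W} (hφ : ∀ w, (G.induce (φ ⁻¹' {w})).Connected)
    (hH : ∀ w w', H.Adj w w' → ∃ u v, φ u = w ∧ φ v = w' ∧ G.Adj u v)
    (h : H.HasCliqueMinor k) : G.HasCliqueMinor k := by
  obtain ⟨g, hc, hd, ha⟩ := h
  refine ⟨fun i => φ ⁻¹' g i, fun i => (hc i).induce_preimage hφ hH,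
    fun i j hij => (hd hij).preimage φ, fun i j hij => ?_⟩
  obtain ⟨a, ha, b, hb, hab⟩ := ha hij
  obtain ⟨u, v, rfl, rfl, huv⟩ := hH a b hab
  exact ⟨u, ha, v, hb, huv⟩

theorem HasCliqueMinor.of_identify {x y : V} (hxy : G.Adj x y)
    (h : (G.identify x y).HasCliqueMinor k) : G.HasCliqueMinor k := by
  classical
  let x' : ({y}ᶜ : Set V) := ⟨x, hxy.ne⟩
  let φ : V → ({y}ᶜ : Set V) := fun v => if hv : v = y then x' else ⟨v, hv⟩
  have hφy : φ y = x' := dif_pos rfl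
  have hφ : ∀ v : ({y}ᶜ : Set V), φ v = v := fun v => dif_neg v.2
  have hφ' : ∀ v w, φ v = w ↔ v = w ∨ (v = y ∧ x' = w) := by
    intro v w
    by_cases hv : v = y
    · subst hv
      rw [hφy]
      exact ⟨fun h => Or.inr ⟨rfl, h⟩, fun h => h.elim (fun h => absurd h.symm w.2) And.right⟩
    · rw [hφ ⟨v, hv⟩, Subtype.ext_iff]
      exact ⟨Or.inl, fun h => h.elim id fun h => absurd h.1 hv⟩
  refine HasCliqueMinor.of_contraction (φ := φ) (fun w => ?_) (fun w w' hw => ?_) h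
  · by_cases hw : x' = w
    · subst hw
      have : φ ⁻¹' {x'} = {x, y} := by
        ext v
        simp [hφ', x']
      rw [this]
      exact G.induce_pair_connected_of_adj hxy
    · have : φ ⁻¹' {w} = {(w : V)} := by
        ext v
        simp [hφ', hw]
      rw [this]
      exact Connected.of_subsingleton
  · rcases hw.2 with h | h | h
    · exact ⟨w, w', hφ w, hφ w', h⟩
    · exact ⟨y, w', hφy.trans (Subtype.ext h.1.symm), hφ w', h.2⟩
    · exact ⟨w, y, hφ w, hφy.trans (Subtype.ext h.1.symm), h.2.symm⟩

theorem HasCliqueMinor.of_le {G' : SimpleGraph V} (hle : G' ≤ G) (h : G'.HasCliqueMinor k) :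
    G.HasCliqueMinor k :=
  h.map (Hom.ofLE hle) Function.injective_id

theorem HasCliqueMinor.of_induce {s : Set V} (h : (G.induce s).HasCliqueMinor k) :
    G.HasCliqueMinor k :=
  h.map (Embedding.induce s).toHom Subtype.val_injective

theorem hasCliqueMinor_top [Finite V] : (⊤ : SimpleGraph V).HasCliqueMinor (Nat.card V) := by
  let e := (Finite.equivFin V).symm
  refine ⟨fun i => {e i}, fun i => Connected.of_subsingleton, fun i j hij => ?_, fun i j hij => ?_⟩
  · simpa using hij
  · exact ⟨e i, rfl, e j, rfl, by simpa using hij⟩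

end Minors

/-! ### Edges lost by deleting a vertex or contracting an edge. -/

section EdgeCounts

variable {V : Type*} (G : SimpleGraph V)

theorem sum_ncard_neighborSet [Fintype V] :
    ∑ v, (G.neighborSet v).ncard = 2 * G.edgeSet.ncard := by
  classical
  have h := G.sum_degrees_eq_twice_card_edges
  rw [← coe_edgeFinset, Set.ncard_coe_finset, ← h]
  refine Finset.sum_congr rfl fun v _ => ?_
  rw [← card_neighborFinset_eq_degree, ← Set.ncard_coe_finset, coe_neighborFinset]

theorem exists_le_ncard_edgeSet_eq {m : ℕ} (h : m ≤ G.edgeSet.ncard) :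
    ∃ G' ≤ G, G'.edgeSet.ncard = m := by
  obtain ⟨s, hs, hm⟩ := Set.exists_subset_card_eq h
  refine ⟨fromEdgeSet s, ?_, ?_⟩
  · rw [fromEdgeSet_le]
    exact Set.sdiff_subset.trans hs
  · rw [edgeSet_fromEdgeSet, sdiff_eq_left.2, hm]
    rw [Set.disjoint_left]
    intro e he hes
    exact G.not_isDiag_of_mem_edgeSet (hs he) hes

variable [Finite V]

theorem eq_top_of_choose_two_le (h : (Nat.card V).choose 2 ≤ G.edgeSet.ncard) : G = ⊤ := by
  classical
  have := Fintype.ofFinite V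
  rw [← coe_edgeFinset, Set.ncard_coe_finset, Nat.card_eq_fintype_card,
    ← card_edgeFinset_top_eq_card_choose_two] at h
  exact edgeFinset_inj.1 (Finset.eq_of_subset_of_card_le (edgeFinset_mono le_top) h)

theorem ncard_edgeSet_le_induce_compl_add (y : V) :
    G.edgeSet.ncard ≤ (G.induce ({y}ᶜ : Set V)).edgeSet.ncard + (G.neighborSet y).ncard := by
  have hsub : G.edgeSet ⊆ (Sym2.map Subtype.val '' (G.induce ({y}ᶜ : Set V)).edgeSet) ∪
      ((fun w => s(y, w)) '' G.neighborSet y) := by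
    intro e he
    induction e with
    | _ u v =>
      rw [mem_edgeSet] at he
      by_cases hu : u = y
      · subst hu
        exact Or.inr ⟨v, he, rfl⟩
      by_cases hv : v = y
      · subst hv
        exact Or.inr ⟨u, he.symm, Sym2.eq_swap⟩
      exact Or.inl ⟨s(⟨u, hu⟩, ⟨v, hv⟩), he, rfl⟩
  refine (Set.ncard_le_ncard hsub (Set.toFinite _)).trans ((Set.ncard_union_le _ _).trans ?_)
  exact add_le_add (Set.ncard_image_le (Set.toFinite _)) (Set.ncard_image_le (Set.toFinite _))

/-- Contracting `xy` loses that edge and merges one pair of edges per triangle on `xy`. The set `N`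
collects the neighbors of `y` whose edges survive as new edges at `x`. -/
theorem ncard_edgeSet_le_identify_add {x y : V} (hxy : G.Adj x y) :
    G.edgeSet.ncard ≤ (G.identify x y).edgeSet.ncard +
      ((G.neighborSet x ∩ G.neighborSet y).ncard + 1) := by
  let N : Set ({y}ᶜ : Set V) := {w | G.Adj y w ∧ ¬ G.Adj x w ∧ (w : V) ≠ x}
  let x' : ({y}ᶜ : Set V) := ⟨x, hxy.ne⟩
  have hN : (G.neighborSet y).ncard ≤
      N.ncard + ((G.neighborSet x ∩ G.neighborSet y).ncard + 1) := by
    have hsub : G.neighborSet y ⊆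
        (Subtype.val '' N) ∪ ((G.neighborSet x ∩ G.neighborSet y) ∪ {x}) := by
      intro w hw
      by_cases h1 : G.Adj x w
      · exact Or.inr (Or.inl ⟨h1, hw⟩)
      by_cases h2 : w = x
      · exact Or.inr (Or.inr h2)
      exact Or.inl ⟨⟨w, (G.ne_of_adj hw).symm⟩, ⟨hw, h1, h2⟩, rfl⟩
    refine (Set.ncard_le_ncard hsub (Set.toFinite _)).trans ((Set.ncard_union_le _ _).trans ?_)
    refine add_le_add (Set.ncard_image_le (Set.toFinite _)) ((Set.ncard_union_le _ _).trans ?_)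
    rw [Set.ncard_singleton]
  have hE : (G.induce ({y}ᶜ : Set V)).edgeSet.ncard + N.ncard ≤
      (G.identify x y).edgeSet.ncard := by
    have hinj : Function.Injective fun w : ({y}ᶜ : Set V) => s(x', w) := fun a b h =>
      Sym2.congr_right.1 h
    rw [← Set.ncard_image_of_injective N hinj, ← Set.ncard_union_eq ?_]
    · refine Set.ncard_le_ncard (Set.union_subset ?_ ?_) (Set.toFinite _)
      · intro e he
        induction e with
        | _ u v =>
          rw [mem_edgeSet] at he ⊢
          exact ⟨he.ne, Or.inl he⟩
      · rintro _ ⟨w, hw, rfl⟩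
        rw [mem_edgeSet]
        exact ⟨fun h => hw.2.2 (congrArg Subtype.val h).symm, Or.inr (Or.inl ⟨rfl, hw.1⟩)⟩
    · rw [Set.disjoint_right]
      rintro _ ⟨w, hw, rfl⟩ h
      rw [mem_edgeSet] at h
      exact hw.2.1 h
  have := G.ncard_edgeSet_le_induce_compl_add y
  omega

end EdgeCounts

-- Density forces clique minors.

universe u

/-- The threshold is `a * n - b` edges. `hbase` makes the graph complete at `n = k + 1`, and `hD`
makes `D` large enough for the average degree at the threshold to yield a vertex of degree at most
`D`. -/
theorem HasCliqueMinor.of_dense_of_neighborhoods {k a b D : ℕ}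
    (hbase : (k + 1).choose 2 + b ≤ a * (k + 1))
    (hD : 2 * a < D + 1 ∨ 2 * a = D + 1 ∧ 0 < b)
    (hloc : ∀ (W : Type u) [Finite W] (H : SimpleGraph W), a + 1 ≤ Nat.card W → Nat.card W ≤ D →
      a * Nat.card W ≤ 2 * H.edgeSet.ncard → H.HasCliqueMinor k)
    {V : Type u} [Finite V] (G : SimpleGraph V) (hn : k + 1 ≤ Nat.card V)
    (he : a * Nat.card V ≤ G.edgeSet.ncard + b) : G.HasCliqueMinor (k + 1) := by
  induction hN : Nat.card V generalizing V with
  | zero => omega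
  | succ n ih =>
    rw [hN] at hn he
    rcases Nat.eq_or_lt_of_le hn with hk | hk
    · rw [← hk] at he hN
      have htop : G = ⊤ := G.eq_top_of_choose_two_le (by rw [hN]; omega)
      rw [htop, ← hN]
      exact hasCliqueMinor_top
    have hcard : ∀ y : V, Nat.card ({y}ᶜ : Set V) = n := fun y => by
      have := Set.ncard_add_ncard_compl ({y} : Set V)
      rw [Set.ncard_singleton, hN] at this
      rw [Nat.card_coe_set_eq]
      omega
    -- Trimming to exactly the threshold bounds the average degree from above.
    obtain ⟨G', hle, he'⟩ := G.exists_le_ncard_edgeSet_eq (m := a * (n + 1) - b) (by omega)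
    have hb : b ≤ a * (n + 1) :=
      (Nat.le_add_left _ _).trans (hbase.trans (Nat.mul_le_mul_left a hn))
    have hexp : a * (n + 1) = a * n + a := Nat.mul_succ a n
    refine HasCliqueMinor.of_le hle ?_
    by_cases hdeg : ∃ y, (G'.neighborSet y).ncard ≤ a
    · obtain ⟨y, hy⟩ := hdeg
      have := G'.ncard_edgeSet_le_induce_compl_add y
      refine HasCliqueMinor.of_induce (ih (G'.induce ({y}ᶜ : Set V)) ?_ ?_ (hcard y))
      · rw [hcard]; omega
      · rw [hcard]; omega
    by_cases htri : ∃ x y, G'.Adj x y ∧ (G'.neighborSet x ∩ G'.neighborSet y).ncard < a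
    · obtain ⟨x, y, hxy, ht⟩ := htri
      have := G'.ncard_edgeSet_le_identify_add hxy
      refine HasCliqueMinor.of_identify hxy (ih (G'.identify x y) ?_ ?_ (hcard y))
      · rw [hcard]; omega
      · rw [hcard]; omega
    push Not at hdeg htri
    have := Fintype.ofFinite V
    obtain ⟨v, hv⟩ : ∃ v, (G'.neighborSet v).ncard ≤ D := by
      by_contra! hcon
      have hsum := G'.sum_ncard_neighborSet
      have hge : Fintype.card V * (D + 1) ≤ ∑ v, (G'.neighborSet v).ncard := by
        rw [← smul_eq_mul]
        exact Finset.card_nsmul_le_sum _ _ _ fun v _ => hcon v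
      rw [← Nat.card_eq_fintype_card, hN, hsum, he'] at hge
      rcases hD with hD | ⟨hD, hb0⟩
      · have : (n + 1) * (2 * a) < (n + 1) * (D + 1) := Nat.mul_lt_mul_of_pos_left hD (by omega)
        have h2 : (n + 1) * (2 * a) = 2 * (a * (n + 1)) := by ring
        omega
      · have h2 : (n + 1) * (D + 1) = 2 * (a * (n + 1)) := by rw [← hD]; ring
        omega
    -- Every edge now lies in at least `a` triangles, so the neighborhood of `v` induces a graph of
    -- minimum degree at least `a`.
    refine HasCliqueMinor.succ_of_induce_neighborSet (v := v) (hloc _ _ ?_ ?_ ?_)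
    · rw [Nat.card_coe_set_eq]
      exact hdeg v
    · rwa [Nat.card_coe_set_eq]
    · have := Fintype.ofFinite (G'.neighborSet v)
      rw [← sum_ncard_neighborSet, mul_comm, Nat.card_eq_fintype_card, ← smul_eq_mul]
      refine Finset.card_nsmul_le_sum _ _ _ fun w _ => (htri v w w.2).trans ?_
      rw [← Set.ncard_image_of_injective _ Subtype.val_injective]
      refine Set.ncard_le_ncard ?_ (Set.toFinite _)
      rintro z ⟨hz1, hz2⟩
      exact ⟨⟨z, hz1⟩, hz2, rfl⟩

section Density

variable {V : Type u} (G : SimpleGraph V)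

theorem hasCliqueMinor_zero : G.HasCliqueMinor 0 :=
  ⟨Fin.elim0, fun i => i.elim0, fun i => i.elim0, fun i => i.elim0⟩

theorem hasCliqueMinor_one (hn : 1 ≤ Nat.card V) : G.HasCliqueMinor 1 := by
  obtain ⟨v⟩ := (Nat.card_pos_iff.1 hn).1
  exact ⟨fun _ => {v}, fun _ => Connected.of_subsingleton,
    fun i j hij => absurd (Subsingleton.elim i j) hij,
    fun i j hij => absurd (Subsingleton.elim i j) hij⟩

variable [Finite V]

theorem hasCliqueMinor_two (he : 1 ≤ G.edgeSet.ncard) : G.HasCliqueMinor 2 := by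
  obtain ⟨e, he⟩ := (Set.ncard_pos (Set.toFinite _)).1 he
  induction e with
  | _ u v =>
    refine HasCliqueMinor.succ_of_induce_neighborSet (v := u) (hasCliqueMinor_one _ ?_)
    exact Nat.card_pos_iff.2 ⟨⟨⟨v, he⟩⟩, inferInstance⟩

theorem hasCliqueMinor_three (hn : 3 ≤ Nat.card V) (he : Nat.card V ≤ G.edgeSet.ncard) :
    G.HasCliqueMinor 3 :=
  HasCliqueMinor.of_dense_of_neighborhoods (k := 2) (a := 1) (b := 0) (D := 2) (by decide)
    (by decide) (fun _ _ H _ _ _ => H.hasCliqueMinor_two (by omega)) G hn (by omega)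

theorem hasCliqueMinor_four (hn : 4 ≤ Nat.card V) (he : 2 * Nat.card V ≤ G.edgeSet.ncard + 2) :
    G.HasCliqueMinor 4 :=
  HasCliqueMinor.of_dense_of_neighborhoods (k := 3) (a := 2) (b := 2) (D := 3) (by decide)
    (by decide) (fun _ _ H _ _ _ => H.hasCliqueMinor_three (by omega) (by omega)) G hn he

theorem hasCliqueMinor_five (hn : 5 ≤ Nat.card V) (he : 3 * Nat.card V ≤ G.edgeSet.ncard + 5) :
    G.HasCliqueMinor 5 :=
  HasCliqueMinor.of_dense_of_neighborhoods (k := 4) (a := 3) (b := 5) (D := 5) (by decide)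
    (by decide) (fun _ _ H _ _ _ => H.hasCliqueMinor_four (by omega) (by omega)) G hn he

theorem hasCliqueMinor_six (hn : 6 ≤ Nat.card V) (he : 5 * Nat.card V ≤ G.edgeSet.ncard + 15) :
    G.HasCliqueMinor 6 :=
  HasCliqueMinor.of_dense_of_neighborhoods (k := 5) (a := 5) (b := 15) (D := 9) (by decide)
    (by decide) (fun _ _ H _ _ _ => H.hasCliqueMinor_five (by omega) (by omega)) G hn he

end Density

/-! ### Counting the edges of a Kempe-colored graph. -/

section KempeColorings

variable {V : Type*} {G : SimpleGraph V}

theorem ncard_add_ncard_le_of_connected [Finite V] {A B : Set V} (hA : IsAntichain G.Adj A)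
    (hB : IsAntichain G.Adj B) (hAB : Disjoint A B) (hc : (G.induce (A ∪ B)).Connected) :
    A.ncard + B.ncard ≤ {p : V × V | p.1 ∈ A ∧ p.2 ∈ B ∧ G.Adj p.1 p.2}.ncard + 1 := by
  have h := hc.card_vert_le_card_edgeSet_add_one
  rw [Nat.card_coe_set_eq, Set.ncard_union_eq hAB] at h
  refine h.trans (Nat.add_le_add_right ?_ 1)
  rw [← Nat.card_coe_set_eq {p : V × V | p.1 ∈ A ∧ p.2 ∈ B ∧ G.Adj p.1 p.2}]
  let f : {p : V × V | p.1 ∈ A ∧ p.2 ∈ B ∧ G.Adj p.1 p.2} → (G.induce (A ∪ B)).edgeSet := fun p =>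
    ⟨s(⟨p.1.1, Or.inl p.2.1⟩, ⟨p.1.2, Or.inr p.2.2.1⟩), p.2.2.2⟩
  refine Nat.card_le_card_of_surjective f ?_
  rintro ⟨e, he⟩
  induction e with
  | _ u v =>
    obtain ⟨u, hu⟩ := u
    obtain ⟨v, hv⟩ := v
    have huv : G.Adj u v := he
    rcases hu with hu | hu <;> rcases hv with hv | hv
    · exact absurd huv (hA hu hv huv.ne)
    · exact ⟨⟨(u, v), hu, hv, huv⟩, rfl⟩
    · exact ⟨⟨(v, u), hv, hu, huv.symm⟩, Subtype.ext Sym2.eq_swap⟩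
    · exact absurd huv (hB hu hv huv.ne)

theorem Partition.partOfVertex_eq_iff (C : G.Partition) {A : Set V} (hA : A ∈ C.parts) {v : V} :
    C.partOfVertex v = A ↔ v ∈ A :=
  ⟨fun h => h ▸ C.mem_partOfVertex v, fun h => (C.isPartition.2 v).unique
    ⟨C.partOfVertex_mem v, C.mem_partOfVertex v⟩ ⟨hA, h⟩⟩

theorem Partition.ncard_parts_le_card [Finite V] (C : G.Partition) :
    C.parts.ncard ≤ Nat.card V := by
  rw [← Set.ncard_univ]
  refine (Set.ncard_le_ncard ?_ (Set.toFinite _)).trans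
    (Set.ncard_image_le (f := C.partOfVertex) (Set.toFinite _))
  intro A hA
  obtain ⟨v, hv⟩ := Set.nonempty_iff_ne_empty.2 fun h => C.isPartition.1 (h ▸ hA)
  exact ⟨v, trivial, (C.partOfVertex_eq_iff hA).2 hv⟩

/-- Summing over ordered pairs of distinct classes counts each edge twice; terms are moved across to
avoid natural subtraction. -/
theorem Partition.IsKempe.card_mul_le [Finite V] {C : G.Partition} (hC : C.IsKempe) :
    2 * (C.parts.ncard * Nat.card V) + C.parts.ncard ≤
      2 * (G.edgeSet.ncard + Nat.card V) + C.parts.ncard * C.parts.ncard := by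
  classical
  have := Fintype.ofFinite V
  obtain ⟨P, hP⟩ : ∃ P : Finset (Set V), (P : Set (Set V)) = C.parts :=
    (Set.toFinite C.parts).exists_finset_coe
  have hmem : ∀ {A}, A ∈ P ↔ A ∈ C.parts := fun {A} => by rw [← hP, Finset.mem_coe]
  rw [← hP, Set.ncard_coe_finset]
  have hcard : ∑ A ∈ P, A.ncard = Nat.card V := by
    rw [Nat.card_eq_fintype_card, ← Finset.card_univ, Finset.card_eq_sum_card_fiberwise
      (f := C.partOfVertex) (t := P) fun v _ => hmem.2 (C.partOfVertex_mem v)]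
    refine Finset.sum_congr rfl fun A hA => ?_
    rw [← Set.ncard_coe_finset]
    congr 1
    ext v
    simp [C.partOfVertex_eq_iff (hmem.1 hA)]
  let T : Finset (V × V) := Finset.univ.filter fun p => G.Adj p.1 p.2
  have hT : T.card = 2 * G.edgeSet.ncard := by
    rw [← sum_ncard_neighborSet, Finset.card_filter, Fintype.sum_prod_type]
    refine Finset.sum_congr rfl fun v _ => ?_
    rw [← Finset.card_filter, ← Set.ncard_coe_finset]
    congr 1
    ext w
    simp
  have hpairs : ∑ p ∈ P.offDiag, (p.1.ncard + p.2.ncard) ≤ T.card + P.offDiag.card := by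
    rw [Finset.card_eq_sum_card_fiberwise (s := T) (t := P.offDiag)
      (f := fun p => (C.partOfVertex p.1, C.partOfVertex p.2)), Finset.card_eq_sum_ones,
      ← Finset.sum_add_distrib]
    · refine Finset.sum_le_sum fun p hp => ?_
      obtain ⟨A, B⟩ := p
      obtain ⟨hA, hB, hAB⟩ := Finset.mem_offDiag.1 hp
      rw [hmem] at hA hB
      refine (ncard_add_ncard_le_of_connected (C.independent A hA) (C.independent B hB)
        (C.isPartition.pairwiseDisjoint hA hB hAB) (hC A hA B hB hAB)).trans (le_of_eq ?_)
      rw [← Set.ncard_coe_finset]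
      congr 2
      ext q
      simp only [T, Set.mem_ofPred_eq, Finset.coe_filter, Finset.mem_filter, Finset.mem_univ,
        true_and, Prod.mk.injEq, C.partOfVertex_eq_iff hA, C.partOfVertex_eq_iff hB]
      tauto
    · intro p hp
      have hp' : G.Adj p.1 p.2 := (Finset.mem_filter.1 hp).2
      exact Finset.mem_coe.2 (Finset.mem_offDiag.2 ⟨hmem.2 (C.partOfVertex_mem _),
        hmem.2 (C.partOfVertex_mem _), C.partOfVertex_ne_of_adj hp'⟩)
  have hall : ∑ p ∈ P ×ˢ P, (p.1.ncard + p.2.ncard) = 2 * (P.card * Nat.card V) := by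
    simp only [Finset.sum_product, Finset.sum_add_distrib, Finset.sum_const, smul_eq_mul, hcard,
      ← Finset.mul_sum]
    ring
  rw [← Finset.diag_union_offDiag, Finset.sum_union (Finset.disjoint_diag_offDiag P),
    Finset.sum_diag, Finset.sum_add_distrib, hcard] at hall
  rw [Finset.offDiag_card] at hpairs
  -- Keeps the truncated subtraction in the size of `P.offDiag` exact.
  have := Nat.le_mul_self P.card
  omega

end KempeColorings

end SimpleGraph

theorem theorem2 {V : Type*} [Finite V] (G : SimpleGraph V) (k : ℕ) (hk : k ≤ 6)
    (hG : ∃ C : G.Partition, C.IsKempe ∧ C.parts.ncard = k) :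
    k ≤ G.hadwigerNumber ∧ ∃ K : Set (Set V), G.IsCliqueMinor K ∧ K.ncard = k := by
  obtain ⟨C, hC, rfl⟩ := hG
  suffices h : G.HasCliqueMinor C.parts.ncard by
    obtain ⟨K, hK⟩ := h.exists_isCliqueMinor
    exact ⟨G.isGreatest_hadwigerNumber.2 ⟨K, hK⟩, K, hK⟩
  have hn := C.ncard_parts_le_card
  have he := hC.card_mul_le
  generalize C.parts.ncard = k at hk hn he
  interval_cases k
  · exact G.hasCliqueMinor_zero
  · exact G.hasCliqueMinor_one hn
  · exact G.hasCliqueMinor_two (by omega)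
  · exact G.hasCliqueMinor_three hn (by omega)
  · exact G.hasCliqueMinor_four hn (by omega)
  · exact G.hasCliqueMinor_five hn (by omega)
  · exact G.hasCliqueMinor_six hn (by omega)
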